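/- For a sequence $\alpha=\{\alpha_n\}_{n=0}^\infty$ in the closed unit disk $\overline{\mathbb D}\subset\mathbb C$ put $\rho_n=(1-|\alpha_n|^2)^{1/2}$ and $\alpha_{-1}=-1$. The GGT matrix $\mathcal G(\alpha)$ is the infinite matrix with entries ($k,\ell\ge 0$) $$\mathcal G_{k\ell}(\alpha)=\begin{cases}-\overline{\alpha_\ell}\,\alpha_{k-1}\prod_{m=k}^{\ell-1}\rho_m, & 0\le k\le \ell,\\ \rho_\ell, & k=\ell+1,\\ 0, & k\ge \ell+2.\end{cases}$$ (If all $|\alpha_n|<1$, this is $\langle\varphi_k,z\varphi_\ell\rangle$, where the $\varphi_n$ are the orthonormal polynomials on the unit circle with Verblunsky coefficients $\alpha_n$.) **Theorem 10.4.** Let $\alpha=\{\alpha_n\}_{n=0}^\infty$ and $\beta=\{\beta_n\}_{n=0}^\infty$ be two sequences in $\overline{\mathbb D}$, and let $\rho_n=(1-|\alpha_n|^2)^{1/2}$ and $\sigma_n=(1-|\beta_n|^2)^{1/2}$. Then $\mathcal G(\alpha)$ and $\mathcal G(\beta)$ are the matrices, in the standard basis, of bounded operators on $\ell^2(\{0,1,2,\dots\})$,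 and $$\|\mathcal G(\alpha)-\mathcal G(\beta)\|_1\le 2\sum_{n=0}^\infty\bigl(|\alpha_n-\beta_n|+|\sigma_n-\rho_n|\bigr),$$ where $\|A\|_1=\operatorname{Tr}|A|=\sum_n\langle\delta_n,(A^*A)^{1/2}\delta_n\rangle\in[0,\infty]$ is the trace norm, and both sides may be $+\infty$. In particular, if the right-hand side is finite, the difference is trace class. -/

import Mathlib

open scoped ENNReal lp

/-- `ρ = (1 - |α|²)^{1/2}`, the complementary modulus of a point `α` of the closed unit disk. -/
noncomputable def rhoOf (a : ℂ) : ℝ := Real.sqrt (1 - ‖a‖ ^ 2)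

/-- The coefficient `α_{k-1}`, with the boundary convention `α_{-1} = -1`. -/
noncomputable def prevCoeff (α : ℕ → ℂ) : ℕ → ℂ
  | 0 => -1
  | k + 1 => α k

/-- Entry `(k, l)` of the GGT matrix of the sequence `α`:
`- conj α_l * α_{k-1} * ρ_k ⋯ ρ_{l-1}` on and above the diagonal, `ρ_l` on the first
subdiagonal, and `0` below it. For `α` with values in the open disk this is the matrix
`⟨φ_k, z φ_l⟩` in the orthonormal polynomials of the measure with Verblunsky
coefficients `α`. -/
noncomputable def ggt (α : ℕ → ℂ) (k l : ℕ) : ℂ :=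
  if k ≤ l then
    -(starRingEnd ℂ (α l)) * prevCoeff α k * ∏ m ∈ Finset.Ico k l, (rhoOf (α m) : ℂ)
  else if k = l + 1 then (rhoOf (α l) : ℂ)
  else 0

/-- The complex Hilbert space of square-summable sequences indexed by `0, 1, 2, …`. -/
abbrev SeqSpace : Type := ℓ²(ℕ, ℂ)

/-- The standard basis `δ_0, δ_1, …` of `SeqSpace`. -/
noncomputable def stdBasis : HilbertBasis ℕ ℂ SeqSpace :=
  HilbertBasis.ofRepr (LinearIsometryEquiv.refl ℂ SeqSpace)

theorem stdBasis_apply (n : ℕ) : stdBasis n = lp.single 2 n (1 : ℂ) :=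
  (HilbertBasis.repr_symm_single stdBasis n).symm

/-- The bounded operator `A` is the one whose matrix in the standard basis is `M`, that is,
`M k l = ⟨δ_k, A δ_l⟩` with the inner product linear in its second argument
(a bounded operator is determined by its matrix, so there is at most one such `A`). -/
def HasMatrix (A : SeqSpace →L[ℂ] SeqSpace) (M : ℕ → ℕ → ℂ) : Prop :=
  ∀ k l : ℕ, inner ℂ (stdBasis k) (A (stdBasis l)) = M k l

/-- The absolute value `|A| = (A* A)^{1/2}` of a bounded operator on a complex Hilbert space. -/
noncomputable def absOp {H : Type*} [NormedAddCommGroup H] [InnerProductSpace ℂ H]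
    [CompleteSpace H] (A : H →L[ℂ] H) : H →L[ℂ] H :=
  CFC.abs A

/-- The trace norm `‖A‖₁ = Tr |A| = ∑ ⟨b_i, |A| b_i⟩ ∈ [0, ∞]`, computed in an orthonormal
basis `b` (its value does not depend on `b`). It is finite exactly when `A` is trace class.
Each summand is a nonnegative real number because `|A|` is a positive operator. -/
noncomputable def traceNorm {ι H : Type*} [NormedAddCommGroup H] [InnerProductSpace ℂ H]
    [CompleteSpace H] (b : HilbertBasis ι ℂ H) (A : H →L[ℂ] H) : ℝ≥0∞ :=
  ∑' i : ι, ENNReal.ofReal (RCLike.re (inner ℂ (b i) (absOp A (b i))))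

/-!
The columns of `𝒢(α)` are the vectors `z φ_l` of the Szegő recursion, which is a sequence of Givens
rotations, one for each `α_n`, applied to the standard basis; so the columns are orthonormal, and
`𝒢(α)` is an isometry. Replacing `α_n` by `β_n` one rotation at a time telescopes `𝒢(α) - 𝒢(β)`
into a sum over `n` of two rank-one operators. In one, the change in the vector `z φ_n` is paired
with `δ_n`; in the other, the change in `φ_{n+1}^*` is paired with `𝒢(β)^* φ_{n+1}^*(β)`, of norm at
most `1`. Either change has norm at most `|α_n - β_n| + |σ_n - ρ_n|`, and the trace norm of a
pointwise convergent sum of rank-one operators `⟨y_j, ·⟩ x_j` is at most `∑ ‖x_j‖ ‖y_j‖`.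
-/

section Factorization

variable {𝕜 E F G : Type*} [RCLike 𝕜] [AddCommGroup E] [Module 𝕜 E]
  [NormedAddCommGroup F] [InnerProductSpace 𝕜 F] [CompleteSpace F]
  [NormedAddCommGroup G] [NormedSpace 𝕜 G] [CompleteSpace G]

theorem exists_comp_eq_of_norm_apply_le (A : E →ₗ[𝕜] F) (T : E →ₗ[𝕜] G) {C : ℝ} (hC : 0 ≤ C)
    (h : ∀ x, ‖T x‖ ≤ C * ‖A x‖) : ∃ V : F →L[𝕜] G, ‖V‖ ≤ C ∧ ∀ x, V (A x) = T x := by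
  let K := A.range.topologicalClosure
  have : CompleteSpace K := A.range.isClosed_topologicalClosure.completeSpace_coe
  let e : E →ₗ[𝕜] K :=
    A.codRestrict K fun x => A.range.le_topologicalClosure (A.mem_range_self x)
  have he : DenseRange e :=
    ((denseRange_inclusion_iff A.range.le_topologicalClosure).2 subset_rfl).comp
      A.surjective_rangeRestrict.denseRange (continuous_inclusion A.range.le_topologicalClosure)
  refine ⟨T.extendOfNorm e ∘L K.orthogonalProjectionOnto, ?_, fun x => ?_⟩
  · calc ‖T.extendOfNorm e ∘L K.orthogonalProjectionOnto‖
        ≤ ‖T.extendOfNorm e‖ * ‖K.orthogonalProjectionOnto‖ :=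
          ContinuousLinearMap.opNorm_comp_le _ _
      _ ≤ C * 1 := by
          gcongr
          · exact LinearMap.opNorm_extendOfNorm_le he hC h
          · exact K.orthogonalProjectionOnto_norm_le
      _ = C := mul_one C
  · have hproj : K.orthogonalProjectionOnto (A x) = e x :=
      K.orthogonalProjectionOnto_mem_subspace_eq_self (e x)
    rw [ContinuousLinearMap.comp_apply, hproj, LinearMap.extendOfNorm_eq he ⟨C, h⟩]

end Factorization

section Orthonormal

variable {ι 𝕜 E F : Type*} [RCLike 𝕜] [NormedAddCommGroup E] [InnerProductSpace 𝕜 E]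
  [NormedAddCommGroup F] [InnerProductSpace 𝕜 F]

theorem tsum_enorm_inner_mul_enorm_inner_le {v : ι → E} (hv : Orthonormal 𝕜 v) (x y : E) :
    ∑' i, ‖inner 𝕜 x (v i)‖ₑ * ‖inner 𝕜 (v i) y‖ₑ ≤ ‖x‖ₑ * ‖y‖ₑ := by
  rw [ENNReal.tsum_eq_iSup_sum]
  refine iSup_le fun t => ?_
  have hsq : (∑ i ∈ t, ‖inner 𝕜 x (v i)‖ * ‖inner 𝕜 (v i) y‖) ^ 2 ≤ (‖x‖ * ‖y‖) ^ 2 := by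
    calc (∑ i ∈ t, ‖inner 𝕜 x (v i)‖ * ‖inner 𝕜 (v i) y‖) ^ 2
        ≤ (∑ i ∈ t, ‖inner 𝕜 x (v i)‖ ^ 2) * ∑ i ∈ t, ‖inner 𝕜 (v i) y‖ ^ 2 :=
          Finset.sum_mul_sq_le_sq_mul_sq _ _ _
      _ ≤ ‖x‖ ^ 2 * ‖y‖ ^ 2 := by
          simp only [norm_inner_symm x]
          gcongr <;> exact hv.sum_inner_products_le _
      _ = (‖x‖ * ‖y‖) ^ 2 := (mul_pow _ _ 2).symm
  have hsum := le_of_sq_le_sq hsq (by positivity)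
  simp only [← ofReal_norm, ← ENNReal.ofReal_mul (norm_nonneg _)]
  rw [← ENNReal.ofReal_sum_of_nonneg fun _ _ => by positivity]
  exact ENNReal.ofReal_le_ofReal hsum

theorem exists_linearIsometry_apply_eq [CompleteSpace F] (b : HilbertBasis ι 𝕜 E) {v : ι → F}
    (hv : Orthonormal 𝕜 v) : ∃ V : E →ₗᵢ[𝕜] F, ∀ i, V (b i) = v i := by
  classical
  refine ⟨hv.orthogonalFamily.linearIsometry.comp b.repr.toLinearIsometry, fun i => ?_⟩
  calc hv.orthogonalFamily.linearIsometry (b.repr (b i))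
      = LinearIsometry.toSpanSingleton 𝕜 F (hv.norm_eq_one i) 1 := by
        rw [b.repr_self, OrthogonalFamily.linearIsometry_apply_single]
    _ = v i := one_smul 𝕜 (v i)

theorem orthonormal_pair_iff {u v : E} :
    Orthonormal 𝕜 ![u, v] ↔ ‖u‖ = 1 ∧ ‖v‖ = 1 ∧ inner 𝕜 u v = 0 := by
  simp only [Nat.succ_eq_add_one, Nat.reduceAdd, orthonormal_vecCons_iff,
    Matrix.cons_val_fin_one, forall_const, orthonormal_subsingleton_iff, and_congr_right_iff]
  tauto

end Orthonormal

section TraceNorm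

variable {ι κ H : Type*} [NormedAddCommGroup H] [InnerProductSpace ℂ H] [CompleteSpace H]

theorem norm_absOp_apply (A : H →L[ℂ] H) (x : H) : ‖absOp A x‖ = ‖A x‖ := by
  have hself : (absOp A).adjoint = absOp A :=
    (IsSelfAdjoint.of_nonneg (CFC.abs_nonneg A)).adjoint_eq
  have hsq : (absOp A).adjoint ∘L absOp A = A.adjoint ∘L A := by
    rw [hself]
    exact CFC.abs_mul_abs A
  rw [(absOp A).apply_norm_eq_sqrt_inner_adjoint_left, hsq, A.apply_norm_eq_sqrt_inner_adjoint_left]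

-- With `|A| = V A` and `‖V‖ ≤ 1`, each rank-one term contributes
-- `∑ i, |⟪y j, b i⟫ ⟪b i, V (x j)⟫| ≤ ‖y j‖ ‖x j‖` to the trace of `|A|`.
theorem traceNorm_le_tsum_of_hasSum_rankOne (b : HilbertBasis ι ℂ H) (A : H →L[ℂ] H)
    (x y : κ → H) (hA : ∀ i, HasSum (fun j => inner ℂ (y j) (b i) • x j) (A (b i))) :
    traceNorm b A ≤ ∑' j, ‖x j‖ₑ * ‖y j‖ₑ := by
  obtain ⟨V, hV, hVA⟩ := exists_comp_eq_of_norm_apply_le A.toLinearMap (absOp A).toLinearMap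
    zero_le_one fun x => by simpa using (norm_absOp_apply A x).le
  have hterm (i : ι) : ENNReal.ofReal (RCLike.re (inner ℂ (b i) (absOp A (b i)))) ≤
      ∑' j, ‖inner ℂ (y j) (b i)‖ₑ * ‖inner ℂ (b i) (V (x j))‖ₑ := by
    have hsum : HasSum (fun j => inner ℂ (y j) (b i) * inner ℂ (b i) (V (x j)))
        (inner ℂ (b i) (absOp A (b i))) := by
      have hinner := ((hA i).mapL V).mapL (innerSL ℂ (b i))
      have hVA' : V (A (b i)) = absOp A (b i) := hVA (b i)
      simpa only [innerSL_apply_apply, map_smul, smul_eq_mul, hVA'] using hinner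
    calc ENNReal.ofReal (RCLike.re (inner ℂ (b i) (absOp A (b i))))
        ≤ ‖inner ℂ (b i) (absOp A (b i))‖ₑ := by
          rw [← ofReal_norm]
          exact ENNReal.ofReal_le_ofReal (RCLike.re_le_norm _)
      _ ≤ ∑' j, ‖inner ℂ (y j) (b i)‖ₑ * ‖inner ℂ (b i) (V (x j))‖ₑ := by
          rw [← hsum.tsum_eq]
          simp only [← enorm_mul]
          exact enorm_tsum_le_tsum_enorm
  calc traceNorm b A
      ≤ ∑' i, ∑' j, ‖inner ℂ (y j) (b i)‖ₑ * ‖inner ℂ (b i) (V (x j))‖ₑ :=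
        ENNReal.tsum_le_tsum hterm
    _ = ∑' j, ∑' i, ‖inner ℂ (y j) (b i)‖ₑ * ‖inner ℂ (b i) (V (x j))‖ₑ := ENNReal.tsum_comm
    _ ≤ ∑' j, ‖y j‖ₑ * ‖V (x j)‖ₑ :=
        ENNReal.tsum_le_tsum fun j => tsum_enorm_inner_mul_enorm_inner_le b.orthonormal _ _
    _ ≤ ∑' j, ‖x j‖ₑ * ‖y j‖ₑ := by
        refine ENNReal.tsum_le_tsum fun j => ?_
        rw [mul_comm]
        gcongr
        exact enorm_le_iff_norm_le.2 (V.le_of_opNorm_le_of_le hV le_rfl |>.trans_eq (one_mul _))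

end TraceNorm

section Givens

/-- The image `conj a • u + ρ • v` of the first vector of the pair `(u, v)` under the Givens
rotation `[[conj a, ρ], [ρ, -a]]`, where `ρ = (1 - |a|²)^{1/2}`. -/
noncomputable def givensFst {E : Type*} [AddCommGroup E] [Module ℂ E] (a : ℂ) (u v : E) : E :=
  starRingEnd ℂ a • u + (rhoOf a : ℂ) • v

/-- The image `ρ • u - a • v` of the second vector of the pair `(u, v)` under the Givens
rotation `[[conj a, ρ], [ρ, -a]]`, where `ρ = (1 - |a|²)^{1/2}`. -/
noncomputable def givensSnd {E : Type*} [AddCommGroup E] [Module ℂ E] (a : ℂ) (u v : E) : E :=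
  (rhoOf a : ℂ) • u - a • v

theorem norm_givensFst_sub_le {E : Type*} [SeminormedAddCommGroup E] [NormedSpace ℂ E]
    (a c : ℂ) (u v : E) :
    ‖givensFst a u v - givensFst c u v‖ ≤ ‖a - c‖ * ‖u‖ + |rhoOf c - rhoOf a| * ‖v‖ := by
  have : givensFst a u v - givensFst c u v =
      starRingEnd ℂ (a - c) • u + ((rhoOf a - rhoOf c : ℝ) : ℂ) • v := by
    simp only [givensFst, map_sub, Complex.ofReal_sub]
    module
  rw [this]
  refine (norm_add_le _ _).trans_eq ?_
  rw [norm_smul, norm_smul, RCLike.norm_conj, Complex.norm_real, Real.norm_eq_abs, abs_sub_comm]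

theorem norm_givensSnd_sub_le {E : Type*} [SeminormedAddCommGroup E] [NormedSpace ℂ E]
    (a c : ℂ) (u v : E) :
    ‖givensSnd a u v - givensSnd c u v‖ ≤ ‖a - c‖ * ‖v‖ + |rhoOf c - rhoOf a| * ‖u‖ := by
  have : givensSnd a u v - givensSnd c u v =
      ((rhoOf a - rhoOf c : ℝ) : ℂ) • u - (a - c) • v := by
    simp only [givensSnd, Complex.ofReal_sub]
    module
  rw [this]
  refine (norm_sub_le _ _).trans_eq ?_
  rw [norm_smul, norm_smul, Complex.norm_real, Real.norm_eq_abs, abs_sub_comm, add_comm]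

theorem norm_sq_add_rhoOf_sq {a : ℂ} (ha : ‖a‖ ≤ 1) : ‖a‖ ^ 2 + rhoOf a ^ 2 = 1 := by
  rw [rhoOf, Real.sq_sqrt (by nlinarith [norm_nonneg a]), add_sub_cancel]

theorem orthonormal_givens {E : Type*} [NormedAddCommGroup E] [InnerProductSpace ℂ E] {a : ℂ}
    (ha : ‖a‖ ≤ 1) {u v : E} (h : Orthonormal ℂ ![u, v]) :
    Orthonormal ℂ ![givensFst a u v, givensSnd a u v] := by
  obtain ⟨hu, hv, huv⟩ := orthonormal_pair_iff.1 h
  have hvu : inner ℂ v u = 0 := inner_eq_zero_symm.1 huv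
  have norm_eq_one_of_sq {x : E} (hx : ‖x‖ ^ 2 = 1) : ‖x‖ = 1 :=
    (pow_eq_one_iff_of_nonneg (norm_nonneg x) two_ne_zero).1 hx
  refine orthonormal_pair_iff.2 ⟨norm_eq_one_of_sq ?_, norm_eq_one_of_sq ?_, ?_⟩
  · rw [givensFst, norm_add_sq (𝕜 := ℂ), inner_smul_left, inner_smul_right, huv]
    simp [norm_smul, hu, hv, norm_sq_add_rhoOf_sq ha]
  · rw [givensSnd, norm_sub_sq (𝕜 := ℂ), inner_smul_left, inner_smul_right, huv]
    simp [norm_smul, hu, hv, add_comm (rhoOf a ^ 2), norm_sq_add_rhoOf_sq ha]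
  · simp only [givensFst, givensSnd, inner_add_left, inner_sub_right, inner_smul_left,
      inner_smul_right, inner_self_eq_one_of_norm_eq_one hu, inner_self_eq_one_of_norm_eq_one hv,
      huv, hvu, Complex.conj_conj, Complex.conj_ofReal]
    ring

end Givens

section Szego

variable {E : Type*} [NormedAddCommGroup E] [InnerProductSpace ℂ E]

/-- The vector of the reversed orthonormal polynomial `φ_n^*` when `e k` stands for `φ_k`, defined
by the Szegő recursion `φ_{n+1}^* = ρ_n φ_n^* - α_n φ_{n+1}`. In this form the recursion makes
sense for all `α` in the closed disk. -/
noncomputable def szegoDual (e : ℕ → E) (α : ℕ → ℂ) : ℕ → E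
  | 0 => e 0
  | n + 1 => givensSnd (α n) (szegoDual e α n) (e (n + 1))

/-- The vector of `z φ_n = conj α_n φ_n^* + ρ_n φ_{n+1}` when `e k` stands for `φ_k`; its
coordinates are the `n`-th column of the GGT matrix. -/
noncomputable def szegoShift (e : ℕ → E) (α : ℕ → ℂ) (n : ℕ) : E :=
  givensFst (α n) (szegoDual e α n) (e (n + 1))

variable {e : ℕ → E} (he : Orthonormal ℂ e)

section Coordinates

include he

theorem inner_szegoDual_of_lt (α : ℕ → ℂ) {k n : ℕ} (h : n < k) :
    inner ℂ (e k) (szegoDual e α n) = 0 := by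
  induction n with
  | zero => exact he.inner_eq_zero h.ne'
  | succ n ih =>
    rw [szegoDual, givensSnd, inner_sub_right, inner_smul_right, inner_smul_right,
      ih (by omega), he.inner_eq_zero h.ne', mul_zero, mul_zero, sub_zero]

theorem inner_szegoDual_of_le (α : ℕ → ℂ) {k n : ℕ} (h : k ≤ n) :
    inner ℂ (e k) (szegoDual e α n) =
      -prevCoeff α k * ∏ m ∈ Finset.Ico k n, (rhoOf (α m) : ℂ) := by
  have inner_self (k : ℕ) : inner ℂ (e k) (e k) = 1 :=
    inner_self_eq_one_of_norm_eq_one (he.norm_eq_one k)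
  induction n, h using Nat.le_induction with
  | base =>
    cases k with
    | zero => rw [szegoDual, inner_self, prevCoeff, Finset.Ico_self, Finset.prod_empty]; ring
    | succ k =>
      rw [szegoDual, givensSnd, inner_sub_right, inner_smul_right, inner_smul_right, inner_self,
        inner_szegoDual_of_lt he α k.lt_succ_self, prevCoeff, Finset.Ico_self, Finset.prod_empty]
      ring
  | succ n hkn ih =>
    rw [szegoDual, givensSnd, inner_sub_right, inner_smul_right, inner_smul_right, ih,
      he.inner_eq_zero (by omega), Finset.prod_Ico_succ_top hkn]
    ring

theorem inner_szegoShift (α : ℕ → ℂ) (k l : ℕ) : inner ℂ (e k) (szegoShift e α l) = ggt α k l := by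
  rw [szegoShift, givensFst, inner_add_right, inner_smul_right, inner_smul_right, ggt]
  split_ifs with hkl hk
  · rw [inner_szegoDual_of_le he α hkl, he.inner_eq_zero (by omega)]
    ring
  · rw [inner_szegoDual_of_lt he α (by omega), hk,
      inner_self_eq_one_of_norm_eq_one (he.norm_eq_one _), mul_zero, zero_add, mul_one]
  · rw [inner_szegoDual_of_lt he α (by omega), he.inner_eq_zero hk, mul_zero, mul_zero, add_zero]

theorem inner_szegoShift_of_lt (α : ℕ → ℂ) {k l : ℕ} (h : l + 1 < k) :
    inner ℂ (e k) (szegoShift e α l) = 0 := by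
  rw [inner_szegoShift he, ggt, if_neg (by omega), if_neg (by omega)]

end Coordinates

section Orthonormality

variable {α : ℕ → ℂ} (hα : ∀ n, ‖α n‖ ≤ 1)
include he hα

theorem orthonormal_szegoDual_basis (n : ℕ) : Orthonormal ℂ ![szegoDual e α n, e (n + 1)] := by
  have pair_of_norm (m : ℕ) (hm : ‖szegoDual e α m‖ = 1) :
      Orthonormal ℂ ![szegoDual e α m, e (m + 1)] :=
    orthonormal_pair_iff.2 ⟨hm, he.norm_eq_one _,
      inner_eq_zero_symm.1 (inner_szegoDual_of_lt he α m.lt_succ_self)⟩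
  refine pair_of_norm n ?_
  induction n with
  | zero => exact he.norm_eq_one 0
  | succ n ih => exact (orthonormal_pair_iff.1 (orthonormal_givens (hα n) (pair_of_norm n ih))).2.1

theorem norm_szegoDual (n : ℕ) : ‖szegoDual e α n‖ = 1 :=
  (orthonormal_pair_iff.1 (orthonormal_szegoDual_basis he hα n)).1

theorem orthonormal_szegoShift_szegoDual (n : ℕ) :
    Orthonormal ℂ ![szegoShift e α n, szegoDual e α (n + 1)] :=
  orthonormal_givens (hα n) (orthonormal_szegoDual_basis he hα n)

theorem inner_szegoDual_szegoShift_of_lt {n m : ℕ} (h : n < m) :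
    inner ℂ (szegoDual e α m) (szegoShift e α n) = 0 := by
  induction m, h using Nat.le_induction with
  | base =>
    exact inner_eq_zero_symm.1
      (orthonormal_pair_iff.1 (orthonormal_szegoShift_szegoDual he hα n)).2.2
  | succ m hnm ih =>
    rw [szegoDual, givensSnd, inner_sub_left, inner_smul_left, inner_smul_left, ih,
      inner_szegoShift_of_lt he α (by omega), mul_zero, mul_zero, sub_zero]

theorem orthonormal_szegoShift : Orthonormal ℂ (szegoShift e α) := by
  have inner_of_lt {n m : ℕ} (h : n < m) :
      inner ℂ (szegoShift e α m) (szegoShift e α n) = 0 := by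
    rw [szegoShift, givensFst, inner_add_left, inner_smul_left, inner_smul_left,
      inner_szegoDual_szegoShift_of_lt he hα h, inner_szegoShift_of_lt he α (by omega), mul_zero,
      mul_zero, add_zero]
  refine ⟨fun n => (orthonormal_pair_iff.1 (orthonormal_szegoShift_szegoDual he hα n)).1,
    fun n m hnm => ?_⟩
  rcases hnm.lt_or_gt with h | h
  · exact inner_eq_zero_symm.1 (inner_of_lt h)
  · exact inner_of_lt h

end Orthonormality

section Telescoping

/-- The change of `szegoDual e α (n + 1)` when its last Givens parameter `α n` is replaced
by `β n`. -/
noncomputable def szegoDualStep (e : ℕ → E) (α β : ℕ → ℂ) (n : ℕ) : E :=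
  szegoDual e α (n + 1) - givensSnd (β n) (szegoDual e α n) (e (n + 1))

/-- The change of `szegoShift e α n` when its last Givens parameter `α n` is replaced
by `β n`. -/
noncomputable def szegoShiftStep (e : ℕ → E) (α β : ℕ → ℂ) (n : ℕ) : E :=
  szegoShift e α n - givensFst (β n) (szegoDual e α n) (e (n + 1))

include he

theorem norm_szegoDualStep_le {α : ℕ → ℂ} (hα : ∀ n, ‖α n‖ ≤ 1) (β : ℕ → ℂ) (n : ℕ) :
    ‖szegoDualStep e α β n‖ ≤ ‖α n - β n‖ + |rhoOf (β n) - rhoOf (α n)| := by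
  have h := norm_givensSnd_sub_le (α n) (β n) (szegoDual e α n) (e (n + 1))
  rwa [norm_szegoDual he hα, he.norm_eq_one, mul_one, mul_one] at h

theorem norm_szegoShiftStep_le {α : ℕ → ℂ} (hα : ∀ n, ‖α n‖ ≤ 1) (β : ℕ → ℂ) (n : ℕ) :
    ‖szegoShiftStep e α β n‖ ≤ ‖α n - β n‖ + |rhoOf (β n) - rhoOf (α n)| := by
  have h := norm_givensFst_sub_le (α n) (β n) (szegoDual e α n) (e (n + 1))
  rwa [norm_szegoDual he hα, he.norm_eq_one, mul_one, mul_one] at h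

theorem inner_szegoDual_szegoDual_succ (β : ℕ → ℂ) {n l : ℕ} (h : n ≤ l) :
    inner ℂ (szegoDual e β n) (szegoDual e β (l + 1)) =
      rhoOf (β l) * inner ℂ (szegoDual e β n) (szegoDual e β l) := by
  rw [szegoDual.eq_2 e β l, givensSnd, inner_sub_right, inner_smul_right, inner_smul_right,
    inner_eq_zero_symm.1 (inner_szegoDual_of_lt he β (by omega)), mul_zero, sub_zero]

theorem inner_szegoDual_szegoShift_of_le (β : ℕ → ℂ) {n l : ℕ} (h : n ≤ l) :
    inner ℂ (szegoDual e β n) (szegoShift e β l) =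
      starRingEnd ℂ (β l) * inner ℂ (szegoDual e β n) (szegoDual e β l) := by
  rw [szegoShift, givensFst, inner_add_right, inner_smul_right, inner_smul_right,
    inner_eq_zero_symm.1 (inner_szegoDual_of_lt he β (by omega)), mul_zero, add_zero]

variable (α : ℕ → ℂ) {β : ℕ → ℂ} (hβ : ∀ n, ‖β n‖ ≤ 1)
include hβ

theorem szegoDual_sub_szegoDual (l : ℕ) :
    szegoDual e α l - szegoDual e β l = ∑ n ∈ Finset.range l,
      inner ℂ (szegoDual e β (n + 1)) (szegoDual e β l) • szegoDualStep e α β n := by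
  induction l with
  | zero => simp [szegoDual]
  | succ l ih =>
    have hlast : inner ℂ (szegoDual e β (l + 1)) (szegoDual e β (l + 1)) = 1 :=
      inner_self_eq_one_of_norm_eq_one (norm_szegoDual he hβ _)
    calc szegoDual e α (l + 1) - szegoDual e β (l + 1)
        = (rhoOf (β l) : ℂ) • (szegoDual e α l - szegoDual e β l) + szegoDualStep e α β l := by
          simp only [szegoDualStep, szegoDual, givensSnd]
          module
      _ = ∑ n ∈ Finset.range (l + 1),
          inner ℂ (szegoDual e β (n + 1)) (szegoDual e β (l + 1)) • szegoDualStep e α β n := by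
          rw [ih, Finset.smul_sum, Finset.sum_range_succ, hlast, one_smul]
          congr 1
          refine Finset.sum_congr rfl fun n hn => ?_
          rw [inner_szegoDual_szegoDual_succ he β (Finset.mem_range.1 hn), mul_smul]

theorem szegoShift_sub_szegoShift (l : ℕ) :
    szegoShift e α l - szegoShift e β l = szegoShiftStep e α β l + ∑ n ∈ Finset.range l,
      inner ℂ (szegoDual e β (n + 1)) (szegoShift e β l) • szegoDualStep e α β n := by
  calc szegoShift e α l - szegoShift e β l
      = szegoShiftStep e α β l + starRingEnd ℂ (β l) • (szegoDual e α l - szegoDual e β l) := by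
        simp only [szegoShiftStep, szegoShift, givensFst]
        module
    _ = szegoShiftStep e α β l + ∑ n ∈ Finset.range l,
        inner ℂ (szegoDual e β (n + 1)) (szegoShift e β l) • szegoDualStep e α β n := by
        rw [szegoDual_sub_szegoDual he α hβ, Finset.smul_sum]
        congr 1
        refine Finset.sum_congr rfl fun n hn => ?_
        rw [inner_szegoDual_szegoShift_of_le he β (Finset.mem_range.1 hn), mul_smul]

end Telescoping

end Szego

section HilbertBasis

variable {H : Type*} [NormedAddCommGroup H] [InnerProductSpace ℂ H] [CompleteSpace H]
  (b : HilbertBasis ℕ ℂ H)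

theorem hasSum_szegoShift_sub_szegoShift (α : ℕ → ℂ) {β : ℕ → ℂ} (hβ : ∀ n, ‖β n‖ ≤ 1)
    {B : H →L[ℂ] H} (hB : ∀ l, B (b l) = szegoShift b β l) (l : ℕ) :
    HasSum (fun j => inner ℂ
        (Sum.elim b (fun n => B.adjoint (szegoDual b β (n + 1))) j) (b l) •
          Sum.elim (szegoShiftStep b α β) (szegoDualStep b α β) j)
      (szegoShift b α l - szegoShift b β l) := by
  rw [szegoShift_sub_szegoShift b.orthonormal α hβ]
  refine HasSum.sum ?_ ?_
  · convert hasSum_single l fun n hn => ?_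
    · simp [b.orthonormal.norm_eq_one]
    · simp [b.orthonormal.inner_eq_zero hn]
  · simp only [Function.comp_def, Sum.elim_inr, ContinuousLinearMap.adjoint_inner_left, hB]
    refine hasSum_sum_of_ne_finset_zero fun n hn => ?_
    rw [inner_szegoDual_szegoShift_of_lt b.orthonormal hβ
      (Nat.lt_succ_of_le (by simpa using hn)), zero_smul]

theorem traceNorm_sub_le_of_apply_eq_szegoShift {α β : ℕ → ℂ} (hα : ∀ n, ‖α n‖ ≤ 1)
    (hβ : ∀ n, ‖β n‖ ≤ 1) {A B : H →ₗᵢ[ℂ] H} (hA : ∀ l, A (b l) = szegoShift b α l)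
    (hB : ∀ l, B (b l) = szegoShift b β l) :
    traceNorm b (A.toContinuousLinearMap - B.toContinuousLinearMap) ≤
      2 * ∑' n, ENNReal.ofReal (‖α n - β n‖ + |rhoOf (β n) - rhoOf (α n)|) := by
  let y (n : ℕ) : H := B.toContinuousLinearMap.adjoint (szegoDual b β (n + 1))
  have hy (n : ℕ) : ‖y n‖ ≤ 1 := by
    calc ‖y n‖ ≤ ‖B.toContinuousLinearMap.adjoint‖ * ‖szegoDual b β (n + 1)‖ :=
          ContinuousLinearMap.le_opNorm _ _
      _ ≤ 1 := by
          rw [norm_szegoDual b.orthonormal hβ, mul_one, LinearIsometryEquiv.norm_map]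
          exact B.norm_toContinuousLinearMap_le
  have enorm_mul_le {x z : H} {r : ℝ} (hx : ‖x‖ ≤ r) (hz : ‖z‖ ≤ 1) :
      ‖x‖ₑ * ‖z‖ₑ ≤ ENNReal.ofReal r := by
    rw [← ofReal_norm, ← ofReal_norm, ← ENNReal.ofReal_mul (norm_nonneg x)]
    exact ENNReal.ofReal_le_ofReal ((mul_le_of_le_one_right (norm_nonneg x) hz).trans hx)
  calc traceNorm b (A.toContinuousLinearMap - B.toContinuousLinearMap)
      ≤ ∑' j, ‖Sum.elim (szegoShiftStep b α β) (szegoDualStep b α β) j‖ₑ * ‖Sum.elim b y j‖ₑ := by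
        refine traceNorm_le_tsum_of_hasSum_rankOne b _ _ _ fun l => ?_
        simpa only [sub_apply, LinearIsometry.coe_toContinuousLinearMap, hA, hB] using
          hasSum_szegoShift_sub_szegoShift b α hβ (B := B.toContinuousLinearMap) hB l
    _ = ∑' n, ‖szegoShiftStep b α β n‖ₑ * ‖b n‖ₑ + ∑' n, ‖szegoDualStep b α β n‖ₑ * ‖y n‖ₑ :=
        Summable.tsum_sum ENNReal.summable ENNReal.summable
    _ ≤ 2 * ∑' n, ENNReal.ofReal (‖α n - β n‖ + |rhoOf (β n) - rhoOf (α n)|) := by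
        rw [two_mul]
        gcongr with n n
        · exact enorm_mul_le (norm_szegoShiftStep_le b.orthonormal hα β n)
            (b.orthonormal.norm_eq_one n).le
        · exact enorm_mul_le (norm_szegoDualStep_le b.orthonormal hα β n) (hy n)

theorem theorem10p4_general (α β : ℕ → ℂ) (hα : ∀ n, ‖α n‖ ≤ 1) (hβ : ∀ n, ‖β n‖ ≤ 1) :
    ∃ A B : H →L[ℂ] H,
      (∀ k l, inner ℂ (b k) (A (b l)) = ggt α k l) ∧
      (∀ k l, inner ℂ (b k) (B (b l)) = ggt β k l) ∧
      traceNorm b (A - B) ≤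
        2 * ∑' n, ENNReal.ofReal (‖α n - β n‖ + |rhoOf (β n) - rhoOf (α n)|) := by
  obtain ⟨A, hA⟩ := exists_linearIsometry_apply_eq b (orthonormal_szegoShift b.orthonormal hα)
  obtain ⟨B, hB⟩ := exists_linearIsometry_apply_eq b (orthonormal_szegoShift b.orthonormal hβ)
  refine ⟨A.toContinuousLinearMap, B.toContinuousLinearMap, fun k l => ?_, fun k l => ?_,
    traceNorm_sub_le_of_apply_eq_szegoShift b hα hβ hA hB⟩
  · simp only [LinearIsometry.coe_toContinuousLinearMap, hA, inner_szegoShift b.orthonormal]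
  · simp only [LinearIsometry.coe_toContinuousLinearMap, hB, inner_szegoShift b.orthonormal]

end HilbertBasis

theorem theorem10p4 (α β : ℕ → ℂ) (hα : ∀ n, ‖α n‖ ≤ 1) (hβ : ∀ n, ‖β n‖ ≤ 1) :
    ∃ A B : SeqSpace →L[ℂ] SeqSpace,
      HasMatrix A (ggt α) ∧ HasMatrix B (ggt β) ∧
      traceNorm stdBasis (A - B) ≤
        2 * ∑' n : ℕ, ENNReal.ofReal (‖α n - β n‖ + |rhoOf (β n) - rhoOf (α n)|) :=
  theorem10p4_general stdBasis α β hα hβ
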